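/- Let $b_1,b_2$ be the standard basis of $\mathbb{C}^2$ and let \[ D_{(2,2)} = b_1\otimes b_1\otimes b_2\otimes b_2 + b_1\otimes b_2\otimes b_1\otimes b_2 + b_1\otimes b_2\otimes b_2\otimes b_1 + b_2\otimes b_1\otimes b_1\otimes b_2 + b_2\otimes b_1\otimes b_2\otimes b_1 + b_2\otimes b_2\otimes b_1\otimes b_1 \in (\mathbb{C}^2)^{\otimes 4} \] be the weight-$(2,2)$ Dicke tensor. Let $\mathrm{T} = b_1^{\otimes 4} + b_2^{\otimes 4}$. Tensor powers of 4-tensors are regarded as 4-tensors by grouping legs, with the tensor product bases. For 4-tensors $\phi\in U_1\otimes\cdots\otimes U_4$ and $\psi\in V_1\otimes\cdots\otimes V_4$ over $\mathbb{C}$, with fixed bases, write $\phi\geq\psi$ if $\psi=(A_1\otimes\cdots\otimes A_4)\phi$ for some linear maps $A_i:U_i\to V_i$, and write $\phi\unrhd_{\mathrm M}\psi$ if, after extending both tensors by zero to $\bigotimes_i (U_i\oplus V_i)$, the tensor $\psi$ lies in the Zariski closure of the orbit of $\phi$ under the group of 4-tuples of invertible monomial matrices (matrices with at most one nonzero entry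 in each row and each column). Define, with $\min\emptyset=\infty$, \[ \mathrm{q}(\phi) = \Bigl(\lim_{n\to\infty}\tfrac1n\min\{m\in\mathbb{N} : \phi^{\otimes m}\geq \mathrm{T}^{\otimes n}\}\Bigr)^{-1},\qquad \mathrm{q}_{\mathrm M}(\phi) = \Bigl(\lim_{n\to\infty}\tfrac1n\min\{m\in\mathbb{N} : \phi^{\otimes m}\unrhd_{\mathrm M} \mathrm{T}^{\otimes n}\}\Bigr)^{-1}. \] Then for $\phi = D_{(2,2)}$ both limits exist, and $\mathrm{q}_{\mathrm M}(D_{(2,2)}) = \mathrm{q}(D_{(2,2)}) = 1$. -/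

import Mathlib

open Filter Topology
open scoped ENNReal

noncomputable section

/-- A `k`-tensor in `ℂ^{ι 0} ⊗ ⋯ ⊗ ℂ^{ι (k-1)}`, given by its coordinates in the product of the
standard bases: `φ x` is the coefficient of `b_{x 0} ⊗ ⋯ ⊗ b_{x (k-1)}`. -/
abbrev KTensor {k : ℕ} (ι : Fin k → Type) : Type := ((l : Fin k) → ι l) → ℂ

namespace KTensor

section General

variable {k : ℕ} {ι κ : Fin k → Type}

/-- The tensor `(A₁ ⊗ ⋯ ⊗ A_k) φ`, where `A l` is the matrix, in the standard bases, of a linear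
map `ℂ^{ι l} → ℂ^{κ l}`. -/
def act [∀ l, Fintype (ι l)] (A : ∀ l, Matrix (κ l) (ι l) ℂ) (φ : KTensor ι) : KTensor κ :=
  fun y => ∑ x : ((l : Fin k) → ι l), (∏ l, A l (y l) (x l)) * φ x

/-- The tensor power `φ^{⊗ m}`, regrouped as a `k`-tensor; the basis of the `l`-th leg is the
tensor product basis, indexed by `Fin m → ι l`. -/
def tpow (φ : KTensor ι) (m : ℕ) : KTensor (fun l => Fin m → ι l) :=
  fun x => ∏ j : Fin m, φ (fun l => x l j)

/-- Restriction `φ ≥ ψ`. -/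
def Restricts [∀ l, Fintype (ι l)] (φ : KTensor ι) (ψ : KTensor κ) : Prop :=
  ∃ A : ∀ l, Matrix (κ l) (ι l) ℂ, ψ = act A φ

end General

/-- A monomial matrix: every row and every column has at most one nonzero entry. -/
def IsMonomial {m n : Type} (A : Matrix m n ℂ) : Prop :=
  (∀ i j j', A i j ≠ 0 → A i j' ≠ 0 → j = j') ∧ (∀ i i' j, A i j ≠ 0 → A i' j ≠ 0 → i = i')

/-- The closure of a set of points of `ℂ^σ` in the Zariski topology: the common zeros of all
polynomials that vanish on the set. -/
def zariskiClosure {σ : Type} (S : Set (σ → ℂ)) : Set (σ → ℂ) :=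
  MvPolynomial.zeroLocus ℂ (MvPolynomial.vanishingIdeal ℂ S)

section Degeneration

variable {k : ℕ} {ι κ : Fin k → Type}

/-- The orbit of `φ` under the group of `k`-tuples of invertible monomial matrices. -/
def monomialOrbit [∀ l, Fintype (ι l)] [∀ l, DecidableEq (ι l)] (φ : KTensor ι) :
    Set (KTensor ι) :=
  {χ | ∃ g : ∀ l, GL (ι l) ℂ,
    (∀ l, IsMonomial (g l : Matrix (ι l) (ι l) ℂ)) ∧ χ = act (fun l => (g l : Matrix _ _ ℂ)) φ}

/-- `φ`, extended by zero along the inclusions `ℂ^{ι l} → ℂ^{ι l} ⊕ ℂ^{κ l}`. -/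
def padLeft [∀ l, Fintype (ι l)] [∀ l, DecidableEq (ι l)] [∀ l, DecidableEq (κ l)]
    (φ : KTensor ι) : KTensor (fun l => ι l ⊕ κ l) :=
  act (fun _ => Matrix.of fun w i => if w = Sum.inl i then 1 else 0) φ

/-- `ψ`, extended by zero along the inclusions `ℂ^{κ l} → ℂ^{ι l} ⊕ ℂ^{κ l}`. -/
def padRight [∀ l, Fintype (κ l)] [∀ l, DecidableEq (ι l)] [∀ l, DecidableEq (κ l)]
    (ψ : KTensor κ) : KTensor (fun l => ι l ⊕ κ l) :=
  act (fun _ => Matrix.of fun w i => if w = Sum.inr i then 1 else 0) ψ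

/-- Monomial degeneration `φ ⊵_M ψ`: `ψ` lies in the Zariski closure of the orbit of `φ` under the
group of `k`-tuples of invertible monomial matrices. As `φ` and `ψ` may live in different spaces,
both are first extended by zero to the common space `⨂ (ℂ^{ι l} ⊕ ℂ^{κ l})`. -/
def MonomiallyDegenerates [∀ l, Fintype (ι l)] [∀ l, DecidableEq (ι l)]
    [∀ l, Fintype (κ l)] [∀ l, DecidableEq (κ l)] (φ : KTensor ι) (ψ : KTensor κ) : Prop :=
  padRight (ι := ι) ψ ∈ zariskiClosure (monomialOrbit (padLeft (κ := κ) φ))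

end Degeneration

section Rates

variable {k : ℕ} {ι κ : Fin k → Type} [∀ l, Fintype (ι l)] [∀ l, DecidableEq (ι l)]
  [∀ l, Fintype (κ l)] [∀ l, DecidableEq (κ l)]

/-- `(1/n) min {m ∈ ℕ | φ^{⊗ m} ≥ ψ^{⊗ n}}`, where the minimum of the empty set is `∞`. -/
def rateSeq (φ : KTensor ι) (ψ : KTensor κ) (n : ℕ) : ℝ≥0∞ :=
  (⨅ (m : ℕ) (_ : Restricts (φ.tpow m) (ψ.tpow n)), (m : ℝ≥0∞)) / n

/-- `(1/n) min {m ∈ ℕ | φ^{⊗ m} ⊵_M ψ^{⊗ n}}`, where the minimum of the empty set is `∞`. -/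
def monomialRateSeq (φ : KTensor ι) (ψ : KTensor κ) (n : ℕ) : ℝ≥0∞ :=
  (⨅ (m : ℕ) (_ : MonomiallyDegenerates (φ.tpow m) (ψ.tpow n)), (m : ℝ≥0∞)) / n

/-- The asymptotic conversion rate `ω(φ, ψ) = lim_n (1/n) min {m | φ^{⊗ m} ≥ ψ^{⊗ n}}`. -/
def rate (φ : KTensor ι) (ψ : KTensor κ) : ℝ≥0∞ :=
  limUnder atTop (rateSeq φ ψ)

/-- The asymptotic monomial conversion rate
`ω_M(φ, ψ) = lim_n (1/n) min {m | φ^{⊗ m} ⊵_M ψ^{⊗ n}}`. -/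
def monomialRate (φ : KTensor ι) (ψ : KTensor κ) : ℝ≥0∞ :=
  limUnder atTop (monomialRateSeq φ ψ)

end Rates

/-- The unit (GHZ) tensor `∑_{i ∈ [r]} b_i ⊗ ⋯ ⊗ b_i ∈ (ℂ^r)^{⊗ k}`. -/
def unit (k r : ℕ) : KTensor (fun _ : Fin k => Fin r) :=
  fun x => ∑ i : Fin r, ∏ l : Fin k, if x l = i then 1 else 0

/-- The weight-`lam` Dicke tensor in `(ℂ^n)^{⊗ k}`: the sum of all `b_{x 0} ⊗ ⋯ ⊗ b_{x (k-1)}` such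
that each index `j` occurs exactly `lam j` times in `x`. -/
def dicke (k n : ℕ) (lam : Fin n → ℕ) : KTensor (fun _ : Fin k => Fin n) :=
  fun x => if ∀ j, (Finset.univ.filter fun l => x l = j).card = lam j then 1 else 0

section Subexponent

variable {k : ℕ} {ι : Fin k → Type} [∀ l, Fintype (ι l)] [∀ l, DecidableEq (ι l)]

/-- The subexponent `q(φ) = ω(φ, T)⁻¹`, with `T = b₁ ⊗ ⋯ ⊗ b₁ + b₂ ⊗ ⋯ ⊗ b₂`. -/
def subexponent (φ : KTensor ι) : ℝ≥0∞ := (rate φ (unit k 2))⁻¹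

/-- The monomial subexponent `q_M(φ) = ω_M(φ, T)⁻¹`, with
`T = b₁ ⊗ ⋯ ⊗ b₁ + b₂ ⊗ ⋯ ⊗ b₂`. -/
def monomialSubexponent (φ : KTensor ι) : ℝ≥0∞ := (monomialRate φ (unit k 2))⁻¹

end Subexponent

/-- The weight-`(2,2)` Dicke tensor in `(ℂ²)^{⊗ 4}`. -/
def dicke22 : KTensor (fun _ : Fin 4 => Fin 2) := dicke 4 2 ![2, 2]

end KTensor

end

/-!
Write `D` for the Dicke tensor and `T` for the unit tensor. Both rates turn out to be `1`.

At least `k` copies of `D` are needed for `T^{⊗ k}`: the flattening of `T^{⊗ k}` along one leg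
contains an identity matrix of size `2^k`, while all minors of size above `2^m` of that flattening
vanish on everything obtained from `D^{⊗ m}` by linear maps, hence also on the Zariski closure of
such a set (`card_le_of_restricts`, `card_le_of_monomiallyDegenerates`).

Conversely, `k + O(√k)` copies suffice. The support of `D^{⊗ n}` consists of the quadruples of
binary words of length `n` whose entrywise sum is constantly `2`. It is enough to find `2^k`
quadruples in it, such that the legs of these quadruples can be recombined to a member of the
support only trivially: projecting each leg to the words that occur turns `D^{⊗ n}` into
`T^{⊗ k}`, and a coordinate projection is a limit of invertible monomial matrices
(`restricts_of_pullback`, `monomiallyDegenerates_of_pullback`).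

Such quadruples come from random hashing in the manner of Strassen and Coppersmith–Winograd. Hash
the four legs by affine maps into a finite abelian group `E`, with a common random linear part and
random translations chosen so that the four values add up to zero on the support. Let a diagonal
`{β b} ⊆ E⁴` of zero-sum tuples be given, such that no mixed tuple of its entries has sum zero.
Keep the quadruples whose hash values are some `β b` and which agree in no leg with another one of
the same hash values: these recombine only trivially (`eq_of_mem_isolated`). Two quadruples that
agree in one leg only are hashed with two independent further conditions, those that agree in two
legs with one. There are at most `4 * 18^n` and `12 * 10^n` such pairs, so as soon as `|E|` exceeds
`√3^n` by a constant factor, collisions cost at most half of the expected number of hits, which is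
`6^n |B| / |E|^3` (`exists_card_isolated`). With `|B|` close to `|E|` this is close to `2^n`.

The diagonal is Behrend's: `E = (ℤ / 3L)^r` and `β v = (v, v, v, -3v)`, where `v` runs through the
points of `[0, L)^r` on a sphere (`eq_of_sum_diagonal_eq_zero`). For `L = 3^a` with `a` about `√n`
all losses together are `2^{O(√n)}` (`exists_matching`).
-/

namespace KTensor

/-! ### Coefficients of transformed tensors -/

section Pullback

variable {k : ℕ} {ι κ : Fin k → Type}

/-- A row of each matrix with a single nonzero entry picks out a single coefficient of `φ`. -/
theorem act_apply_of_rows [∀ l, Fintype (ι l)] [∀ l, DecidableEq (ι l)]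
    {A : ∀ l, Matrix (κ l) (ι l) ℂ} (φ : KTensor ι) {y : ∀ l, κ l}
    (f : ∀ l, ι l) (c : Fin k → ℂ) (h : ∀ l x, A l (y l) x = if x = f l then c l else 0) :
    act A φ y = (∏ l, c l) * φ f := by
  unfold act
  rw [Finset.sum_eq_single f]
  · simp [h]
  · intro x _ hx
    obtain ⟨l, hl⟩ := Function.ne_iff.mp hx
    rw [Finset.prod_eq_zero (Finset.mem_univ l) (by rw [h, if_neg hl]), zero_mul]
  · simp

theorem act_apply_eq_zero [∀ l, Fintype (ι l)] {A : ∀ l, Matrix (κ l) (ι l) ℂ} (φ : KTensor ι)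
    {y : ∀ l, κ l} (l : Fin k) (h : ∀ x, A l (y l) x = 0) : act A φ y = 0 := by
  unfold act
  exact Finset.sum_eq_zero fun x _ => by
    rw [Finset.prod_eq_zero (Finset.mem_univ l) (h _), zero_mul]

theorem act_act {μ : Fin k → Type} [∀ l, Fintype (ι l)] [∀ l, Fintype (κ l)]
    [∀ l, DecidableEq (κ l)]
    (B : ∀ l, Matrix (μ l) (κ l) ℂ) (A : ∀ l, Matrix (κ l) (ι l) ℂ) (φ : KTensor ι) :
    act B (act A φ) = act (fun l => B l * A l) φ := by
  funext y
  simp only [act, Matrix.mul_apply, Finset.mul_sum]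
  rw [Finset.sum_comm]
  refine Finset.sum_congr rfl fun z _ => ?_
  rw [Fintype.prod_sum, Finset.sum_mul]
  refine Finset.sum_congr rfl fun x _ => ?_
  rw [Finset.prod_mul_distrib, mul_assoc]

theorem padLeft_inl [∀ l, Fintype (ι l)] [∀ l, DecidableEq (ι l)] [∀ l, DecidableEq (κ l)]
    (φ : KTensor ι) (x : ∀ l, ι l) :
    padLeft (κ := κ) φ (fun l => Sum.inl (x l)) = φ x := by
  unfold padLeft
  rw [act_apply_of_rows φ x (fun _ => 1)]
  · simp
  · intro l z
    simp [eq_comm]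

theorem padRight_inr [∀ l, Fintype (κ l)] [∀ l, DecidableEq (ι l)] [∀ l, DecidableEq (κ l)]
    (ψ : KTensor κ) (y : ∀ l, κ l) :
    padRight (ι := ι) ψ (fun l => Sum.inr (y l)) = ψ y := by
  unfold padRight
  rw [act_apply_of_rows ψ y (fun _ => 1)]
  · simp
  · intro l z
    simp [eq_comm]

theorem padRight_eq_zero [∀ l, Fintype (κ l)] [∀ l, DecidableEq (ι l)] [∀ l, DecidableEq (κ l)]
    (ψ : KTensor κ) {w : ∀ l, ι l ⊕ κ l} {l : Fin k} {x : ι l}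
    (h : w l = Sum.inl x) : padRight ψ w = 0 :=
  act_apply_eq_zero ψ l (by simp [h])

/-- A tensor whose coefficients are read off from those of `φ` is a restriction of `φ`. -/
theorem restricts_of_pullback [∀ l, Fintype (ι l)] [∀ l, DecidableEq (ι l)] (φ : KTensor ι)
    (ψ : KTensor κ) (e : ∀ l, κ l → ι l)
    (h : ∀ y, ψ y = φ (fun l => e l (y l))) : Restricts φ ψ := by
  refine ⟨fun l => Matrix.of fun y x => if x = e l y then 1 else 0, ?_⟩
  funext y
  rw [act_apply_of_rows φ (fun l => e l (y l)) (fun _ => 1) (fun _ _ => rfl), h]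
  simp

end Pullback

/-! ### Monomial matrices -/

section Swap

variable {X Y : Type}

open Classical in
/-- The map of `X ⊕ Y` that exchanges `e y` and `y` and fixes all other points. -/
noncomputable def swapFun (e : Y → X) : X ⊕ Y → X ⊕ Y :=
  Sum.elim (fun x => if h : ∃ y, e y = x then Sum.inr h.choose else Sum.inl x)
    (fun y => Sum.inl (e y))

theorem swapFun_inl {e : Y → X} (he : Function.Injective e) (y : Y) :
    swapFun e (Sum.inl (e y)) = Sum.inr y := by
  have h : ∃ y', e y' = e y := ⟨y, rfl⟩
  simp only [swapFun, Sum.elim_inl, dif_pos h]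
  exact congrArg _ (he h.choose_spec)

theorem swapFun_involutive {e : Y → X} (he : Function.Injective e) :
    Function.Involutive (swapFun e) := by
  rintro (x | y)
  · by_cases h : ∃ y, e y = x
    · obtain ⟨y, rfl⟩ := h
      rw [swapFun_inl he]
      rfl
    · have : swapFun e (Sum.inl x) = Sum.inl x := by simp only [swapFun, Sum.elim_inl, dif_neg h]
      rw [this, this]
  · exact swapFun_inl he y

/-- The matrix that permutes the coordinates by `σ` and then scales them by `d`. -/
noncomputable def scaledPerm {W : Type} [DecidableEq W] (σ : Equiv.Perm W) (d : W → ℂ) :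
    Matrix W W ℂ :=
  Matrix.of fun i j => if j = σ i then d i else 0

theorem isMonomial_scaledPerm {W : Type} [DecidableEq W] (σ : Equiv.Perm W) (d : W → ℂ) :
    IsMonomial (scaledPerm σ d) := by
  constructor
  · intro i j j' h h'
    simp only [scaledPerm, Matrix.of_apply, ne_eq, ite_eq_right_iff, Classical.not_imp] at h h'
    rw [h.1, h'.1]
  · intro i i' j h h'
    simp only [scaledPerm, Matrix.of_apply, ne_eq, ite_eq_right_iff, Classical.not_imp] at h h'
    exact σ.injective (h.1.symm.trans h'.1)

theorem det_scaledPerm_ne_zero {W : Type} [Fintype W] [DecidableEq W] (σ : Equiv.Perm W)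
    {d : W → ℂ} (hd : ∀ i, d i ≠ 0) : (scaledPerm σ d).det ≠ 0 := by
  have : scaledPerm σ d = Matrix.diagonal d * σ.permMatrix ℂ := by
    ext i j
    simp [scaledPerm, Matrix.diagonal_mul, Equiv.Perm.permMatrix, PEquiv.toMatrix_apply, eq_comm]
  rw [this, Matrix.det_mul, Matrix.det_diagonal, Matrix.det_permutation]
  refine mul_ne_zero (Finset.prod_ne_zero_iff.mpr fun i _ => hd i) ?_
  exact_mod_cast (Equiv.Perm.sign σ).ne_zero

end Swap

/-! ### Degenerations from pullbacks -/

section Degenerate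

variable {k : ℕ} {ι κ : Fin k → Type} [∀ l, Fintype (ι l)] [∀ l, DecidableEq (ι l)]
  [∀ l, Fintype (κ l)] [∀ l, DecidableEq (κ l)]

/-- A tensor whose coefficients are read off from those of `φ` along injections is a monomial
degeneration of `φ`: the curve of matrices that moves the chosen coordinates to the second summand
and scales the remaining ones by `t` has the extension of the tensor as its limit at `t = 0`. -/
theorem monomiallyDegenerates_of_pullback (φ : KTensor ι) (ψ : KTensor κ) (e : ∀ l, κ l → ι l)
    (he : ∀ l, Function.Injective (e l)) (h : ∀ y, ψ y = φ (fun l => e l (y l))) :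
    MonomiallyDegenerates φ ψ := by
  let σ : ∀ l, Equiv.Perm (ι l ⊕ κ l) := fun l => (swapFun_involutive (he l)).toPerm
  let d : ∀ l, ℂ → ι l ⊕ κ l → ℂ := fun l t => Sum.elim (fun _ => t) (fun _ => 1)
  let curve : ℂ → KTensor (fun l => ι l ⊕ κ l) := fun t w =>
    (∏ l, d l t (w l)) * padLeft φ (fun l => σ l (w l))
  have horbit : ∀ t, t ≠ 0 → curve t ∈ monomialOrbit (padLeft (κ := κ) φ) := by
    intro t ht
    have hd : ∀ l w, d l t w ≠ 0 := by
      rintro l (x | y)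
      · exact ht
      · exact one_ne_zero
    refine ⟨fun l => Matrix.GeneralLinearGroup.mkOfDetNeZero _
      (det_scaledPerm_ne_zero (σ l) (hd l)), fun l => isMonomial_scaledPerm _ _, ?_⟩
    funext w
    exact (act_apply_of_rows _ (fun l => σ l (w l)) _ fun l x => rfl).symm
  have hzero : curve 0 = padRight ψ := by
    funext w
    by_cases hw : ∃ l x, w l = Sum.inl x
    · obtain ⟨l, x, hx⟩ := hw
      rw [padRight_eq_zero ψ hx]
      have : d l 0 (w l) = 0 := by rw [hx]; rfl
      simp only [curve]
      rw [Finset.prod_eq_zero (Finset.mem_univ l) this, zero_mul]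
    · have hy : ∀ l, ∃ y, w l = Sum.inr y := by
        intro l
        rcases hwl : w l with x | y
        · exact absurd ⟨l, x, hwl⟩ hw
        · exact ⟨y, rfl⟩
      choose y hy using hy
      obtain rfl : w = fun l => Sum.inr (y l) := funext hy
      have hσ : (fun l => σ l (Sum.inr (y l))) = fun l => Sum.inl (e l (y l)) := rfl
      simp only [curve]
      rw [padRight_inr, h, hσ, padLeft_inl]
      simp [d]
  rw [MonomiallyDegenerates, ← hzero, zariskiClosure, MvPolynomial.mem_zeroLocus_iff]
  intro p hp
  rw [MvPolynomial.mem_vanishingIdeal_iff] at hp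
  -- The restriction of `p` to the curve, a polynomial in `t`, vanishes for all `t ≠ 0`.
  let q : Polynomial ℂ := MvPolynomial.aeval (fun w => (∏ l, Sum.elim (fun _ => Polynomial.X)
    (fun _ => 1) (w l)) * Polynomial.C (padLeft φ (fun l => σ l (w l)))) p
  have hq : ∀ t, q.eval t = MvPolynomial.aeval (curve t) p := by
    intro t
    have : q.eval t = (Polynomial.aeval t) q := by simp
    rw [this, ← AlgHom.comp_apply, MvPolynomial.comp_aeval]
    congr 2
    funext w
    simp only [curve, map_mul, map_prod, Polynomial.aeval_C, Algebra.algebraMap_self,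
      RingHom.id_apply]
    congr 1
    refine Finset.prod_congr rfl fun l _ => ?_
    rcases w l with x | y <;> simp [d]
  have hq0 : q = 0 := by
    refine Polynomial.eq_zero_of_infinite_isRoot q
      ((Set.finite_singleton (0 : ℂ)).infinite_compl.mono fun t ht => ?_)
    rw [Set.mem_ofPred_eq, Polynomial.IsRoot, hq]
    exact hp _ (horbit t ht)
  rw [← hq, hq0, Polynomial.eval_zero]

end Degenerate

/-! ### Minors of flattenings -/

section Flattening

variable {k : ℕ} {ι κ : Fin k → Type} [∀ l, Fintype (ι l)]

/-- Minors of a flattening of `(A₁ ⊗ ⋯ ⊗ A_k) φ` that are larger than the dimension of the leg of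
`φ` vanish. -/
theorem det_flattening_act_eq_zero {τ : Type} [Fintype τ] [DecidableEq τ]
    (A : ∀ l, Matrix (κ l) (ι l) ℂ) (φ : KTensor ι) (l₀ : Fin k) (r : τ → κ l₀)
    (c : τ → ∀ l, κ l) (h : Fintype.card (ι l₀) < Fintype.card τ) :
    (Matrix.of fun i j => act A φ (Function.update (c j) l₀ (r i))).det = 0 := by
  classical
  -- The matrix factors through the space of leg `l₀` of `φ`.
  let P : Matrix τ (ι l₀) ℂ := Matrix.of fun i a => A l₀ (r i) a
  let G : Matrix (ι l₀) τ ℂ := Matrix.of fun a j => ∑ x : (∀ l, ι l),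
    if a = x l₀ then (∏ l ∈ Finset.univ.erase l₀, A l (c j l) (x l)) * φ x else 0
  have hPG : (Matrix.of fun i j => act A φ (Function.update (c j) l₀ (r i))) = P * G := by
    ext i j
    simp only [Matrix.of_apply, Matrix.mul_apply, P, G, act, Finset.mul_sum]
    rw [Finset.sum_comm]
    refine Finset.sum_congr rfl fun x _ => ?_
    simp only [mul_ite, mul_zero, Finset.sum_ite_eq', Finset.mem_univ, if_true]
    rw [← Finset.mul_prod_erase _ _ (Finset.mem_univ l₀), Function.update_self, mul_assoc]
    congr 2
    refine Finset.prod_congr rfl fun l hl => ?_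
    rw [Function.update_of_ne (Finset.ne_of_mem_erase hl)]
  by_contra hdet
  have hrank := Matrix.rank_of_isUnit _ ((Matrix.isUnit_iff_isUnit_det _).mpr
    (isUnit_iff_ne_zero.mpr hdet))
  rw [hPG] at hrank
  have := (Matrix.rank_mul_le_left P G).trans (Matrix.rank_le_card_width P)
  omega

/-- If a flattening of `ψ` has an invertible minor of size `τ`, then so large a leg is needed to
restrict to `ψ`. -/
theorem card_le_of_restricts {τ : Type} [Fintype τ] [DecidableEq τ] {φ : KTensor ι}
    {ψ : KTensor κ} (h : Restricts φ ψ) (l₀ : Fin k) (r : τ → κ l₀) (c : τ → ∀ l, κ l)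
    (hdet : (Matrix.of fun i j => ψ (Function.update (c j) l₀ (r i))).det ≠ 0) :
    Fintype.card τ ≤ Fintype.card (ι l₀) := by
  by_contra hlt
  obtain ⟨A, rfl⟩ := h
  exact hdet (det_flattening_act_eq_zero A φ l₀ r c (not_le.mp hlt))

/-- The same bound for degenerations: the vanishing of a minor is a polynomial condition, so it
passes to the Zariski closure. -/
theorem card_le_of_monomiallyDegenerates [∀ l, DecidableEq (ι l)] [∀ l, Fintype (κ l)]
    [∀ l, DecidableEq (κ l)] {τ : Type} [Fintype τ] [DecidableEq τ] {φ : KTensor ι}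
    {ψ : KTensor κ} (h : MonomiallyDegenerates φ ψ) (l₀ : Fin k) (r : τ → κ l₀)
    (c : τ → ∀ l, κ l)
    (hdet : (Matrix.of fun i j => ψ (Function.update (c j) l₀ (r i))).det ≠ 0) :
    Fintype.card τ ≤ Fintype.card (ι l₀) := by
  by_contra hlt
  rw [not_le] at hlt
  let leg : τ → τ → ∀ l, ι l ⊕ κ l := fun i j =>
    Function.update (fun l => Sum.inr (c j l)) l₀ (Sum.inr (r i))
  let p : MvPolynomial (∀ l, ι l ⊕ κ l) ℂ :=
    (Matrix.of fun i j => MvPolynomial.X (leg i j)).det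
  have hp : ∀ χ : KTensor (fun l => ι l ⊕ κ l), MvPolynomial.aeval χ p =
      (Matrix.of fun i j => χ (leg i j)).det := by
    intro χ
    simp only [p]
    rw [AlgHom.map_det]
    congr 1
    ext i j
    simp
  rw [MonomiallyDegenerates, zariskiClosure, MvPolynomial.mem_zeroLocus_iff] at h
  refine hdet ?_
  rw [← h p ?_, hp]
  · congr 1
    ext i j
    have : leg i j = fun l => Sum.inr (Function.update (c j) l₀ (r i) l) := by
      funext l
      by_cases hl : l = l₀
      · subst hl; simp [leg]
      · simp [leg, hl]
    simp only [Matrix.of_apply]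
    rw [this, padRight_inr]
  · rw [MvPolynomial.mem_vanishingIdeal_iff]
    rintro _ ⟨g, -, rfl⟩
    rw [hp, padLeft, act_act]
    exact det_flattening_act_eq_zero _ φ l₀ _ _ hlt

end Flattening

/-! ### Collisions in the support of powers of the Dicke tensor -/

section Hash

variable {n : ℕ} {E : Type} [AddCommGroup E]

/-- The homomorphism `w ↦ ∑ t, u t • w t` attached to a binary word `u`. -/
def pairing (u : Fin n → Fin 2) : (Fin n → E) →+ E where
  toFun w := ∑ t, (u t : ℕ) • w t
  map_zero' := by simp
  map_add' := by simp [Finset.sum_add_distrib]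

theorem pairing_apply (u : Fin n → Fin 2) (w : Fin n → E) :
    pairing u w = ∑ t, (u t : ℕ) • w t := rfl

theorem pairing_single (u : Fin n → Fin 2) (s : Fin n) (z : E) :
    pairing u (Pi.single s z) = (u s : ℕ) • z := by
  rw [pairing_apply, Finset.sum_eq_single s]
  · simp
  · intro t _ ht
    simp [ht]
  · simp

/-- At a position where two words differ, the difference of their letters is `±1`, so that it acts
invertibly on any abelian group. -/
theorem exists_pairing_sub_single {u v : Fin n → Fin 2} {s : Fin n} (h : u s ≠ v s) (a : E) :
    ∃ z : E, pairing u (Pi.single s z) - pairing v (Pi.single s z) = a := by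
  simp only [pairing_single]
  generalize u s = i at h
  generalize v s = j at h
  fin_cases i <;> fin_cases j
  · exact absurd rfl h
  · exact ⟨-a, by simp⟩
  · exact ⟨a, by simp⟩
  · exact absurd rfl h

theorem card_ker_mul_card {G H : Type} [AddCommGroup G] [AddCommGroup H] [Fintype G] [Fintype H]
    [DecidableEq H] (f : G →+ H) (hf : Function.Surjective f) :
    (Finset.univ.filter fun g => f g = 0).card * Fintype.card H = Fintype.card G := by
  have h := f.ker.card_mul_index
  rw [AddSubgroup.index_ker, AddMonoidHom.range_eq_top.mpr hf] at h
  simp only [Nat.card_eq_fintype_card, AddSubgroup.card_top] at h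
  rw [← h]
  congr 1
  exact (Fintype.card_of_subtype _ fun g => by simp [AddMonoidHom.mem_ker]).symm

variable [Fintype E] [DecidableEq E]

/-- The parameters `w` that do not separate the words `x` and `y` in any leg. -/
def nonseparating (E : Type) [AddCommGroup E] [Fintype E] [DecidableEq E]
    (x y : Fin n → Fin 4 → Fin 2) : Finset (Fin n → E) :=
  Finset.univ.filter fun w => ∀ l, pairing (fun t => x t l) w = pairing (fun t => y t l) w

/-- The letters of the words in the support of a power of the Dicke tensor. -/
def balanced : Finset (Fin 4 → Fin 2) :=
  Finset.univ.filter fun a => ∀ j, (Finset.univ.filter fun l => a l = j).card = ![2, 2] j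

theorem sum_of_mem_balanced : ∀ a ∈ balanced, ∑ l, (a l : ℕ) = 2 := by decide +kernel

/-- Two balanced letters that agree in one leg and differ in another one agree in a third leg. -/
theorem exists_agree_of_mem_balanced : ∀ a ∈ balanced, ∀ b ∈ balanced, ∀ i j, a i = b i →
    a j ≠ b j → ∃ l, l ≠ i ∧ a l = b l := by decide +kernel

theorem card_balanced : balanced.card = 6 := by decide +kernel

theorem card_balanced_agree : ∀ i, ((balanced ×ˢ balanced).filter
    fun p => p.1 i = p.2 i).card = 18 := by decide +kernel

theorem card_balanced_agree_two : ∀ i j, i ≠ j → ((balanced ×ˢ balanced).filter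
    fun p => p.1 i = p.2 i ∧ p.1 j = p.2 j).card = 10 := by decide +kernel

/-- The support of the `n`-th power of the Dicke tensor. -/
def words (n : ℕ) : Finset (Fin n → Fin 4 → Fin 2) := Fintype.piFinset fun _ => balanced

theorem card_words (n : ℕ) : (words n).card = 6 ^ n := by
  simp [words, card_balanced]

theorem mem_words {x : Fin n → Fin 4 → Fin 2} : x ∈ words n ↔ ∀ t, x t ∈ balanced := by
  simp [words]

/-- Pairs of words that satisfy a condition letter by letter are counted letter by letter. -/
theorem card_filter_words (n : ℕ) (P : (Fin 4 → Fin 2) → (Fin 4 → Fin 2) → Prop)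
    [∀ a b, Decidable (P a b)] :
    ((words n ×ˢ words n).filter fun p => ∀ t, P (p.1 t) (p.2 t)).card =
      ((balanced ×ˢ balanced).filter fun p => P p.1 p.2).card ^ n := by
  have := Fintype.card_piFinset_const ((balanced ×ˢ balanced).filter fun p => P p.1 p.2) n
  rw [← this]
  refine Finset.card_bij' (fun p _ t => (p.1 t, p.2 t))
    (fun q _ => (fun t => (q t).1, fun t => (q t).2)) ?_ ?_ ?_ ?_
  · intro p hp
    simp only [Finset.mem_filter, Finset.mem_product, mem_words, Fintype.mem_piFinset] at hp ⊢
    exact fun t => ⟨⟨hp.1.1 t, hp.1.2 t⟩, hp.2 t⟩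
  · intro p hp
    simp only [Finset.mem_filter, Finset.mem_product, mem_words, Fintype.mem_piFinset] at hp ⊢
    exact ⟨⟨fun t => (hp t).1.1, fun t => (hp t).1.2⟩, fun t => (hp t).2⟩
  · intros; rfl
  · intros; rfl

/-- Distinct words are separated in some leg, so only a fraction `1 / |E|` of the parameters fails
to separate them. -/
theorem card_nonseparating_mul_le {x y : Fin n → Fin 4 → Fin 2} (h : x ≠ y) :
    (nonseparating E x y).card * Fintype.card E ≤ Fintype.card E ^ n := by
  obtain ⟨s, hs⟩ := Function.ne_iff.mp h
  obtain ⟨l, hl⟩ := Function.ne_iff.mp hs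
  let f : (Fin n → E) →+ E := pairing (fun t => x t l) - pairing (fun t => y t l)
  have hf : Function.Surjective f := fun a => by
    obtain ⟨z, hz⟩ := exists_pairing_sub_single (u := fun t => x t l) (v := fun t => y t l) hl a
    exact ⟨_, hz⟩
  have := card_ker_mul_card f hf
  rw [Fintype.card_fun, Fintype.card_fin] at this
  rw [← this]
  refine Nat.mul_le_mul_right _ (Finset.card_le_card fun w hw => ?_)
  simp only [nonseparating, Finset.mem_filter, Finset.mem_univ, true_and] at hw ⊢
  exact sub_eq_zero.mpr (hw l)

/-- Balanced words that agree in exactly one leg have differences spanning a group of rank two in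
the remaining legs: at a position where one of these legs differs, another one agrees. -/
theorem card_nonseparating_mul_sq_le {x y : Fin n → Fin 4 → Fin 2} (hx : x ∈ words n)
    (hy : y ∈ words n) (h : x ≠ y) {i : Fin 4} (hi : ∀ t, x t i = y t i)
    (hne : ∀ j, j ≠ i → ∃ t, x t j ≠ y t j) :
    (nonseparating E x y).card * Fintype.card E ^ 2 ≤ Fintype.card E ^ n := by
  obtain ⟨s, hs⟩ := Function.ne_iff.mp h
  obtain ⟨j, hj⟩ := Function.ne_iff.mp hs
  obtain ⟨l, hli, hl⟩ := exists_agree_of_mem_balanced _ (mem_words.mp hx s) _ (mem_words.mp hy s)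
    i j (hi s) hj
  obtain ⟨t, ht⟩ := hne l hli
  let δ : Fin 4 → (Fin n → E) →+ E := fun l => pairing (fun t => x t l) - pairing (fun t => y t l)
  let f : (Fin n → E) →+ E × E := (δ j).prod (δ l)
  have hf : Function.Surjective f := fun ⟨a, b⟩ => by
    obtain ⟨z, hz⟩ := exists_pairing_sub_single (u := fun t => x t l) (v := fun t => y t l) ht b
    obtain ⟨z', hz'⟩ := exists_pairing_sub_single (u := fun t => x t j) (v := fun t => y t j) hj
      (a - δ j (Pi.single t z))
    have h1 : δ l (Pi.single t z) = b := hz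
    have h2 : δ j (Pi.single s z') = a - δ j (Pi.single t z) := hz'
    have h3 : δ l (Pi.single s z') = 0 := by
      simp [δ, AddMonoidHom.sub_apply, pairing_single, hl]
    refine ⟨Pi.single t z + Pi.single s z', ?_⟩
    simp only [f, AddMonoidHom.prod_apply, map_add, h1, h2, h3]
    simp
  have := card_ker_mul_card f hf
  rw [Fintype.card_fun, Fintype.card_fin, Fintype.card_prod, ← sq] at this
  rw [← this]
  refine Nat.mul_le_mul_right _ (Finset.card_le_card fun w hw => ?_)
  simp only [nonseparating, Finset.mem_filter, Finset.mem_univ, true_and] at hw ⊢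
  exact Prod.ext (sub_eq_zero.mpr (hw j)) (sub_eq_zero.mpr (hw l))

/-- Pairs of distinct words in the support that agree in a leg. -/
def collisions (n : ℕ) : Finset ((Fin n → Fin 4 → Fin 2) × (Fin n → Fin 4 → Fin 2)) :=
  (words n ×ˢ words n).filter fun p => p.1 ≠ p.2 ∧ ∃ i, ∀ t, p.1 t i = p.2 t i

/-- The two bounds for pairs of words that agree in one leg or in two legs, combined in one sum over
all legs and all pairs of distinct legs. -/
theorem card_nonseparating_mul_sq_le_sum {p : (Fin n → Fin 4 → Fin 2) × (Fin n → Fin 4 → Fin 2)}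
    (hp : p ∈ collisions n) :
    (nonseparating E p.1 p.2).card * Fintype.card E ^ 2 ≤
      (∑ i, if ∀ t, p.1 t i = p.2 t i then Fintype.card E ^ n else 0) +
      ∑ q ∈ (Finset.univ : Finset (Fin 4)).offDiag,
        if ∀ t, p.1 t q.1 = p.2 t q.1 ∧ p.1 t q.2 = p.2 t q.2 then Fintype.card E ^ (n + 1)
          else 0 := by
  simp only [collisions, Finset.mem_filter, Finset.mem_product] at hp
  obtain ⟨⟨hx, hy⟩, hne, i, hi⟩ := hp
  -- Agreement in a second leg allows the weaker bound, at the price of a factor `|E|`.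
  by_cases hj : ∃ j, j ≠ i ∧ ∀ t, p.1 t j = p.2 t j
  · obtain ⟨j, hji, hj⟩ := hj
    have h1 := Nat.mul_le_mul_right (Fintype.card E) (card_nonseparating_mul_le (E := E) hne)
    rw [mul_assoc, ← sq, ← pow_succ] at h1
    refine h1.trans (le_add_left ?_)
    refine le_trans ?_ (Finset.single_le_sum (fun _ _ => Nat.zero_le _)
      (show (j, i) ∈ (Finset.univ : Finset (Fin 4)).offDiag by simp [hji]))
    rw [if_pos fun t => ⟨hj t, hi t⟩]
  · push Not at hj
    refine (card_nonseparating_mul_sq_le hx hy hne hi hj).trans (le_add_right ?_)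
    refine le_trans ?_ (Finset.single_le_sum (fun _ _ => Nat.zero_le _) (Finset.mem_univ i))
    rw [if_pos hi]

theorem sum_card_nonseparating_le (n : ℕ) :
    (∑ p ∈ collisions n, (nonseparating E p.1 p.2).card) * Fintype.card E ^ 2 ≤
      4 * (18 ^ n * Fintype.card E ^ n) + 12 * (10 ^ n * Fintype.card E ^ (n + 1)) := by
  rw [Finset.sum_mul]
  refine (Finset.sum_le_sum fun p hp => card_nonseparating_mul_sq_le_sum hp).trans ?_
  refine (Finset.sum_le_sum_of_subset (Finset.filter_subset _ _)).trans ?_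
  rw [Finset.sum_add_distrib, Finset.sum_comm, Finset.sum_comm (t := Finset.offDiag _)]
  refine add_le_add (le_of_eq ?_) (le_of_eq ?_)
  · rw [Finset.sum_congr rfl (g := fun _ => 18 ^ n * Fintype.card E ^ n)]
    · simp
    · intro i _
      rw [← Finset.sum_filter, Finset.sum_const, smul_eq_mul,
        card_filter_words n fun a b => a i = b i, card_balanced_agree]
  · rw [Finset.sum_congr rfl (g := fun _ => 10 ^ n * Fintype.card E ^ (n + 1))]
    · rw [Finset.sum_const, smul_eq_mul]
      rfl
    · intro q hq
      rw [← Finset.sum_filter, Finset.sum_const, smul_eq_mul,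
        card_filter_words n fun a b => a q.1 = b q.1 ∧ a q.2 = b q.2,
        card_balanced_agree_two _ _ (Finset.mem_offDiag.mp hq).2.2]

/-- On average over the parameters, collisions use up at most half of the words. -/
theorem two_mul_sum_card_nonseparating_le (hE : 3 ^ (n + 8) ≤ Fintype.card E ^ 2) :
    2 * ∑ p ∈ collisions n, (nonseparating E p.1 p.2).card ≤ 6 ^ n * Fintype.card E ^ n := by
  set M := Fintype.card E
  have h := sum_card_nonseparating_le (E := E) n
  set K := ∑ p ∈ collisions n, (nonseparating E p.1 p.2).card
  have hM : 0 < M ^ 2 := lt_of_lt_of_le (by positivity) hE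
  -- The term `10 ^ n` is compared after squaring, where `100 ≤ 36 * 3` is used.
  have h1 : 81 * 10 ^ n ≤ 6 ^ n * M := by
    refine (Nat.pow_le_pow_iff_left two_ne_zero).mp ?_
    calc (81 * 10 ^ n) ^ 2 = 3 ^ 8 * 100 ^ n := by
          rw [mul_pow, ← pow_mul, mul_comm n, pow_mul]; norm_num
      _ ≤ 3 ^ 8 * 108 ^ n := by gcongr; norm_num
      _ = 36 ^ n * 3 ^ (n + 8) := by
        rw [pow_add, show (108 : ℕ) = 36 * 3 by norm_num, mul_pow]; ring
      _ ≤ 36 ^ n * M ^ 2 := by gcongr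
      _ = (6 ^ n * M) ^ 2 := by rw [mul_pow, ← pow_mul, mul_comm n, pow_mul]; norm_num
  have h2 : 6561 * 18 ^ n ≤ 6 ^ n * M ^ 2 := by
    calc 6561 * 18 ^ n = 6 ^ n * 3 ^ (n + 8) := by
          rw [pow_add, show (18 : ℕ) = 6 * 3 by norm_num, mul_pow]; ring
      _ ≤ 6 ^ n * M ^ 2 := by gcongr
  refine Nat.le_of_mul_le_mul_right ?_ hM
  have h3 := Nat.mul_le_mul_right (M ^ n) h2
  have h4 := Nat.mul_le_mul_right (M ^ (n + 1)) h1
  have e : 6 ^ n * M * M ^ (n + 1) = 6 ^ n * M ^ 2 * M ^ n := by ring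
  rw [e] at h4
  have e' : 6 ^ n * M ^ n * M ^ 2 = 6 ^ n * M ^ 2 * M ^ n := by ring
  rw [e']
  rw [mul_assoc] at h3 h4
  generalize 6 ^ n * M ^ 2 * M ^ n = Z at *
  generalize 18 ^ n * M ^ n = X at *
  generalize 10 ^ n * M ^ (n + 1) = Y at *
  nlinarith

end Hash

/-! ### Averaging over hash functions -/

section Average

variable {n : ℕ} {E : Type} [AddCommGroup E]

/-- The affine hash function of leg `l`, with linear part `ω.1` and translation `ω.2 l`. -/
def legHash (ω : (Fin n → E) × (Fin 4 → E)) (l : Fin 4) (x : Fin n → Fin 4 → Fin 2) : E :=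
  ω.2 l + pairing (fun t => x t l) ω.1

theorem sum_pairing_of_mem_words {x : Fin n → Fin 4 → Fin 2} (hx : x ∈ words n) (w : Fin n → E) :
    ∑ l, pairing (fun t => x t l) w = 2 • ∑ t, w t := by
  simp only [pairing_apply]
  rw [Finset.sum_comm, Finset.smul_sum]
  refine Finset.sum_congr rfl fun t _ => ?_
  rw [← Finset.sum_smul, sum_of_mem_balanced _ (mem_words.mp hx t)]

variable [DecidableEq E]

variable {B : Type} [Fintype B] (β : B → Fin 4 → E)

/-- Words in the support, together with an element of `B` whose hash values they have. -/
def hits (ω : (Fin n → E) × (Fin 4 → E)) : Finset ((Fin n → Fin 4 → Fin 2) × B) :=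
  (words n ×ˢ Finset.univ).filter fun p => ∀ l, legHash ω l p.1 = β p.2 l

/-- Collisions of two words with the same hash values. -/
def clashes (ω : (Fin n → E) × (Fin 4 → E)) :
    Finset (((Fin n → Fin 4 → Fin 2) × (Fin n → Fin 4 → Fin 2)) × B) :=
  (collisions n ×ˢ Finset.univ).filter fun p =>
    (∀ l, legHash ω l p.1.1 = β p.2 l) ∧ ∀ l, legHash ω l p.1.2 = β p.2 l

/-- The words that agree in no leg with another word of the same hash values. -/
def isolated (ω : (Fin n → E) × (Fin 4 → E)) : Finset ((Fin n → Fin 4 → Fin 2) × B) :=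
  (hits β ω).filter fun p => ∀ y ∈ words n, (∀ l, legHash ω l y = β p.2 l) →
    (∃ l, ∀ t, p.1 t l = y t l) → y = p.1

theorem card_hits_le (ω : (Fin n → E) × (Fin 4 → E)) :
    (hits β ω).card ≤ (isolated β ω).card + (clashes β ω).card := by
  classical
  have h : hits β ω ⊆ isolated β ω ∪ (clashes β ω).image fun q => (q.1.1, q.2) := by
    intro p hp
    by_cases hi : p ∈ isolated β ω
    · exact Finset.mem_union_left _ hi
    · refine Finset.mem_union_right _ (Finset.mem_image.mpr ?_)
      simp only [isolated, Finset.mem_filter, hp, true_and] at hi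
      push Not at hi
      obtain ⟨y, hy, hhash, hl, hne⟩ := hi
      simp only [hits, Finset.mem_filter, Finset.mem_product] at hp
      refine ⟨((p.1, y), p.2), ?_, rfl⟩
      simp only [clashes, collisions, Finset.mem_filter, Finset.mem_product]
      exact ⟨⟨⟨⟨hp.1.1, hy⟩, hne.symm, hl⟩, Finset.mem_univ _⟩, hp.2, hhash⟩
  exact (Finset.card_le_card h).trans ((Finset.card_union_le _ _).trans
    (Nat.add_le_add_left Finset.card_image_le _))

variable [Fintype E]

/-- The parameters for which the hash values of the four legs of any word in the support add up
to zero. -/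
def parameters (n : ℕ) (E : Type) [AddCommGroup E] [Fintype E] [DecidableEq E] :
    Finset ((Fin n → E) × (Fin 4 → E)) :=
  Finset.univ.filter fun ω => ∑ l, ω.2 l + 2 • ∑ t, ω.1 t = 0

theorem sum_hash {x : Fin n → Fin 4 → Fin 2} (hx : x ∈ words n)
    {ω : (Fin n → E) × (Fin 4 → E)} (hω : ω ∈ parameters n E) : ∑ l, legHash ω l x = 0 := by
  simp only [legHash, Finset.sum_add_distrib, sum_pairing_of_mem_words hx]
  exact (Finset.mem_filter.mp hω).2

theorem card_parameters_le (n : ℕ) :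
    (parameters n E).card ≤ Fintype.card E ^ n * Fintype.card E ^ 3 := by
  have : Fintype.card E ^ n * Fintype.card E ^ 3 =
      (Finset.univ : Finset ((Fin n → E) × (Fin 3 → E))).card := by simp
  rw [this]
  refine Finset.card_le_card_of_injOn (fun ω => (ω.1, fun i => ω.2 i.succ))
    (fun _ _ => Finset.mem_coe.mpr (Finset.mem_univ _)) ?_
  rintro ⟨w, c⟩ h ⟨w', c'⟩ h' heq
  simp only [Prod.mk.injEq] at heq
  obtain ⟨rfl, hc⟩ := heq
  simp only [parameters, Finset.coe_filter, Finset.mem_univ, true_and, Set.mem_ofPred_eq] at h h'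
  have hc' : ∀ i : Fin 3, c i.succ = c' i.succ := congrFun hc
  have h0 : c 0 = c' 0 := by
    have := h.trans h'.symm
    rw [Fin.sum_univ_succ, Fin.sum_univ_succ (f := c'),
      Finset.sum_congr rfl fun i _ => hc' i] at this
    exact add_right_cancel (add_right_cancel this)
  exact Prod.ext rfl (funext fun i => Fin.cases h0 hc' i)

/-- A word, a linear part and prescribed hash values with sum zero determine the translations. -/
theorem card_pow_le_card_filter_hash {x : Fin n → Fin 4 → Fin 2} (hx : x ∈ words n) {v : Fin 4 → E}
    (hv : ∑ l, v l = 0) :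
    Fintype.card E ^ n ≤ ((parameters n E).filter fun ω => ∀ l, legHash ω l x = v l).card := by
  have : Fintype.card E ^ n = (Finset.univ : Finset (Fin n → E)).card := by simp
  rw [this]
  refine Finset.card_le_card_of_injOn (fun w => (w, fun l => v l - pairing (fun t => x t l) w))
    (fun w _ => ?_) fun w _ w' _ h => congrArg Prod.fst h
  refine Finset.mem_coe.mpr (Finset.mem_filter.mpr
    ⟨Finset.mem_filter.mpr ⟨Finset.mem_univ _, ?_⟩, fun l => sub_add_cancel _ _⟩)
  simp only [Finset.sum_sub_distrib, hv, sum_pairing_of_mem_words hx]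
  abel

/-- If `x` and `y` have the same hash values, then the linear part does not separate them, and it
determines the translations. -/
theorem card_filter_hash_le (x y : Fin n → Fin 4 → Fin 2) (v : Fin 4 → E) :
    ((parameters n E).filter fun ω => (∀ l, legHash ω l x = v l) ∧ ∀ l, legHash ω l y = v l).card ≤
      (nonseparating E x y).card := by
  refine Finset.card_le_card_of_injOn Prod.fst (fun ω hω => ?_) ?_
  · obtain ⟨-, h, h'⟩ := Finset.mem_filter.mp hω
    refine Finset.mem_filter.mpr ⟨Finset.mem_univ _, fun l => ?_⟩
    exact add_left_cancel ((h l).trans (h' l).symm)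
  · rintro ⟨w, c⟩ h ⟨w', c'⟩ h' heq
    obtain rfl : w = w' := heq
    have h := (Finset.mem_filter.mp h).2.1
    have h' := (Finset.mem_filter.mp h').2.1
    exact Prod.ext rfl (funext fun l => add_right_cancel ((h l).trans (h' l).symm))

variable {β}

theorem le_sum_card_hits (h0 : ∀ b, ∑ l, β b l = 0) :
    6 ^ n * Fintype.card B * Fintype.card E ^ n ≤ ∑ ω ∈ parameters n E, (hits β ω).card := by
  have := Finset.sum_card_bipartiteAbove_eq_sum_card_bipartiteBelow (s := parameters n E)
    (t := words n ×ˢ (Finset.univ : Finset B)) fun ω p => ∀ l, legHash ω l p.1 = β p.2 l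
  refine le_trans ?_ this.ge
  rw [← card_words, ← Finset.card_univ (α := B), ← Finset.card_product, ← smul_eq_mul]
  exact Finset.card_nsmul_le_sum _ _ _ fun p hp =>
    card_pow_le_card_filter_hash (Finset.mem_product.mp hp).1 (h0 p.2)

theorem sum_card_clashes_le :
    ∑ ω ∈ parameters n E, (clashes β ω).card ≤
      Fintype.card B * ∑ p ∈ collisions n, (nonseparating E p.1 p.2).card := by
  have := Finset.sum_card_bipartiteAbove_eq_sum_card_bipartiteBelow (s := parameters n E)
    (t := collisions n ×ˢ (Finset.univ : Finset B)) fun ω p =>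
      (∀ l, legHash ω l p.1.1 = β p.2 l) ∧ ∀ l, legHash ω l p.1.2 = β p.2 l
  refine this.le.trans ?_
  rw [Finset.sum_product_right, ← Finset.card_univ, ← smul_eq_mul]
  exact Finset.sum_le_card_nsmul _ _ _ fun b _ => Finset.sum_le_sum fun p _ =>
    card_filter_hash_le p.1 p.2 (β b)

/-- If the diagonal `{β b}` in `E⁴` is free of mixed zero-sum tuples, then the legs of isolated
words can be recombined to a word of the support only trivially. -/
theorem eq_of_mem_isolated (h1 : ∀ b : Fin 4 → B, ∑ l, β (b l) l = 0 → ∀ l, b l = b 0)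
    {ω : (Fin n → E) × (Fin 4 → E)} (hω : ω ∈ parameters n E)
    {z : Fin 4 → (Fin n → Fin 4 → Fin 2) × B} (hz : ∀ l, z l ∈ isolated β ω)
    (hy : (fun t l => (z l).1 t l) ∈ words n) (l : Fin 4) : z l = z 0 := by
  simp only [isolated, hits, Finset.mem_filter] at hz
  have hhash : ∀ l, legHash ω l (fun t l => (z l).1 t l) = β (z l).2 l := fun l => (hz l).1.2 l
  have hb : ∀ l, (z l).2 = (z 0).2 := h1 _ (by simp only [← hhash, sum_hash hy hω])
  -- The recombined word has the hash values `β b` and shares leg `l` with the isolated word `z l`.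
  have key : ∀ l, (fun t l => (z l).1 t l) = (z l).1 := fun l =>
    (hz l).2 _ hy (fun l' => by rw [hhash, hb, hb l]) ⟨l, fun _ => rfl⟩
  exact Prod.ext ((key l).symm.trans (key 0)) (hb l)

/-- The average number of isolated words is at least half the average number of hits, so some choice
of the parameters attains this bound. -/
theorem exists_card_isolated (hE : 3 ^ (n + 8) ≤ Fintype.card E ^ 2)
    (h0 : ∀ b, ∑ l, β b l = 0) :
    ∃ ω ∈ parameters n E,
      6 ^ n * Fintype.card B ≤ 2 * (isolated β ω).card * Fintype.card E ^ 3 := by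
  have hne : (parameters n E).Nonempty := ⟨0, by simp [parameters]⟩
  refine Finset.exists_le_of_sum_le hne ?_
  have hsum := Finset.sum_le_sum fun ω (_ : ω ∈ parameters n E) => card_hits_le β ω
  rw [Finset.sum_add_distrib] at hsum
  have hhits := le_sum_card_hits (n := n) h0
  have hclash := sum_card_clashes_le (n := n) (β := β)
  have hns := Nat.mul_le_mul_left (Fintype.card B) (two_mul_sum_card_nonseparating_le hE)
  rw [Finset.sum_const, smul_eq_mul, ← Finset.sum_mul, ← Finset.mul_sum]
  have hI : 6 ^ n * Fintype.card B * Fintype.card E ^ n ≤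
      2 * ∑ ω ∈ parameters n E, (isolated β ω).card := by
    have e : Fintype.card B * (6 ^ n * Fintype.card E ^ n) =
      6 ^ n * Fintype.card B * Fintype.card E ^ n := by ring
    rw [e] at hns
    linarith
  calc _ ≤ Fintype.card E ^ n * Fintype.card E ^ 3 * (6 ^ n * Fintype.card B) :=
        Nat.mul_le_mul_right _ (card_parameters_le n)
    _ = 6 ^ n * Fintype.card B * Fintype.card E ^ n * Fintype.card E ^ 3 := by ring
    _ ≤ _ := Nat.mul_le_mul_right _ hI

end Average

/-! ### Diagonals without mixed zero-sum tuples -/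

section Sphere

/-- Integer points of the cube `[0, L) ^ r` on the sphere of squared radius `R`. -/
abbrev CubeSphere (r L R : ℕ) : Type := {v : Fin r → Fin L // ∑ i, (v i : ℕ) ^ 2 = R}

/-- The pigeonhole principle for the squared norms of the points of the cube, which are at most
`r * L ^ 2`. -/
theorem exists_card_cubeSphere (r L : ℕ) :
    ∃ R, L ^ r ≤ Fintype.card (CubeSphere r L R) * (r * L ^ 2 + 1) := by
  have hmaps : ∀ v ∈ (Finset.univ : Finset (Fin r → Fin L)),
      ∑ i, (v i : ℕ) ^ 2 ∈ Finset.range (r * L ^ 2 + 1) := by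
    intro v _
    rw [Finset.mem_range, Nat.lt_succ_iff]
    have := Finset.sum_le_card_nsmul Finset.univ (fun i => (v i : ℕ) ^ 2) (L ^ 2)
      fun i _ => Nat.pow_le_pow_left (v i).2.le 2
    simpa using this
  have h := Finset.card_eq_sum_card_fiberwise hmaps
  rw [Finset.card_univ, Fintype.card_fun, Fintype.card_fin, Fintype.card_fin] at h
  obtain ⟨R, -, hR⟩ := Finset.exists_le_of_sum_le (s := Finset.range (r * L ^ 2 + 1))
    (f := fun _ => L ^ r) (g := fun R => (Finset.univ.filter fun v : Fin r → Fin L =>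
      ∑ i, (v i : ℕ) ^ 2 = R).card * (r * L ^ 2 + 1)) ⟨0, by simp⟩ (by
        rw [← Finset.sum_mul, ← h, Finset.sum_const, Finset.card_range, smul_eq_mul, mul_comm])
  exact ⟨R, by rwa [Fintype.card_subtype]⟩

/-- The diagonal tuples `(v, v, v, -3 v)`. -/
def diagonal {r L R : ℕ} (v : CubeSphere r L R) (l : Fin 4) : Fin r → ZMod (3 * L) :=
  fun i => ![1, 1, 1, -3] l * ((v.1 i : ℕ) : ZMod (3 * L))

theorem sum_diagonal {r L R : ℕ} (v : CubeSphere r L R) : ∑ l, diagonal v l = 0 := by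
  funext i
  simp only [diagonal, Fin.sum_univ_four, Pi.add_apply, Pi.zero_apply]
  simp
  ring

/-- Strict convexity of the sphere: the mean of three of its points lies on it only if they
coincide. Entries below `L` make the equation modulo `3 L` an equation of integers. -/
theorem eq_of_sum_diagonal_eq_zero {r L R : ℕ} (v : Fin 4 → CubeSphere r L R)
    (h : ∑ l, diagonal (v l) l = 0) (l : Fin 4) : v l = v 0 := by
  have hnat : ∀ i, ((v 0).1 i + (v 1).1 i + (v 2).1 i : ℕ) = 3 * (v 3).1 i := by
    intro i
    have hi := congrFun h i
    simp only [diagonal, Fin.sum_univ_four, Pi.add_apply, Pi.zero_apply] at hi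
    have hz : (((v 0).1 i + (v 1).1 i + (v 2).1 i : ℕ) : ZMod (3 * L)) =
        ((3 * (v 3).1 i : ℕ) : ZMod (3 * L)) := by
      push_cast
      rw [← sub_eq_zero, ← hi]
      simp
      ring
    rw [ZMod.natCast_eq_natCast_iff'] at hz
    have b0 := ((v 0).1 i).2
    have b1 := ((v 1).1 i).2
    have b2 := ((v 2).1 i).2
    have b3 := ((v 3).1 i).2
    rwa [Nat.mod_eq_of_lt (by omega), Nat.mod_eq_of_lt (by omega)] at hz
  have hR : ∀ l, ∑ i, ((v l).1 i : ℤ) ^ 2 = R := fun l => by exact_mod_cast (v l).2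
  -- The squared distances of the three points to their mean add up to `3 R - 6 R + 3 R = 0`.
  have hsq : ∑ i, ((((v 0).1 i : ℤ) - (v 3).1 i) ^ 2 + (((v 1).1 i : ℤ) - (v 3).1 i) ^ 2 +
      (((v 2).1 i : ℤ) - (v 3).1 i) ^ 2) = 0 := by
    have e : ∀ i, (((v 0).1 i : ℤ) - (v 3).1 i) ^ 2 + (((v 1).1 i : ℤ) - (v 3).1 i) ^ 2 +
        (((v 2).1 i : ℤ) - (v 3).1 i) ^ 2 = ((v 0).1 i : ℤ) ^ 2 + ((v 1).1 i : ℤ) ^ 2 +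
        ((v 2).1 i : ℤ) ^ 2 - 3 * ((v 3).1 i : ℤ) ^ 2 := by
      intro i
      have : (((v 0).1 i : ℕ) : ℤ) + (v 1).1 i + (v 2).1 i = 3 * (v 3).1 i := by
        exact_mod_cast hnat i
      linear_combination (-2 * (((v 3).1 i : ℕ) : ℤ)) * this
    simp only [e, Finset.sum_sub_distrib, Finset.sum_add_distrib, ← Finset.mul_sum, hR]
    ring
  have hall : ∀ l, v l = v 3 := by
    intro l
    refine Subtype.ext (funext fun i => Fin.ext ?_)
    have := (Finset.sum_eq_zero_iff_of_nonneg fun i _ => by positivity).mp hsq i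
      (Finset.mem_univ i)
    have q0 := sq_nonneg (((v 0).1 i : ℤ) - (v 3).1 i)
    have q1 := sq_nonneg (((v 1).1 i : ℤ) - (v 3).1 i)
    have q2 := sq_nonneg (((v 2).1 i : ℤ) - (v 3).1 i)
    have p0 : ((v 0).1 i : ℤ) - (v 3).1 i = 0 := pow_eq_zero_iff two_ne_zero |>.mp (by linarith)
    have p1 : ((v 1).1 i : ℤ) - (v 3).1 i = 0 := pow_eq_zero_iff two_ne_zero |>.mp (by linarith)
    have p2 : ((v 2).1 i : ℤ) - (v 3).1 i = 0 := pow_eq_zero_iff two_ne_zero |>.mp (by linarith)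
    fin_cases l
    · simpa [sub_eq_zero] using p0
    · simpa [sub_eq_zero] using p1
    · simpa [sub_eq_zero] using p2
    · rfl
  rw [hall l, hall 0]

end Sphere

/-! ### Unit tensors inside powers of the Dicke tensor -/

section Matching

/-- The support of `D^{⊗ n}` contains an induced matching, that is, a set of words whose legs
recombine to a word of the support only trivially. Its size is `2^n` up to the factor
`2^(21 + 8 a + 3 r)`, where `r` is about `n / (2 a)`. -/
theorem exists_matching {n a r : ℕ} (h₁ : n + 8 ≤ 2 * (a + 1) * r)
    (h₂ : 2 * (a + 1) * r ≤ n + 10 + 2 * a) :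
    ∃ (B : Type) (D : Finset ((Fin n → Fin 4 → Fin 2) × B)),
      (∀ z ∈ D, z.1 ∈ words n) ∧
      (∀ z : Fin 4 → (Fin n → Fin 4 → Fin 2) × B, (∀ l, z l ∈ D) →
        (fun t l => (z l).1 t l) ∈ words n → ∀ l, z l = z 0) ∧
      2 ^ n ≤ D.card * 2 ^ (21 + 8 * a + 3 * r) := by
  obtain ⟨R, hR⟩ := exists_card_cubeSphere r (3 ^ a)
  have : NeZero (3 * 3 ^ a) := ⟨by positivity⟩
  have hM : Fintype.card (Fin r → ZMod (3 * 3 ^ a)) = 3 ^ r * (3 ^ a) ^ r := by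
    rw [Fintype.card_fun, ZMod.card, Fintype.card_fin, mul_pow]
  have hM2 : (3 ^ r * (3 ^ a) ^ r) ^ 2 = 3 ^ (2 * (a + 1) * r) := by
    rw [← pow_mul, ← pow_add, ← pow_mul]
    congr 1
    ring
  have hE : 3 ^ (n + 8) ≤ Fintype.card (Fin r → ZMod (3 * 3 ^ a)) ^ 2 := by
    rw [hM, hM2]
    exact Nat.pow_le_pow_right (by norm_num) h₁
  obtain ⟨ω, hω, hcard⟩ := exists_card_isolated (β := diagonal (R := R)) hE sum_diagonal
  refine ⟨CubeSphere r (3 ^ a) R, isolated diagonal ω, ?_, ?_, ?_⟩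
  · intro z hz
    exact (Finset.mem_product.mp (Finset.mem_filter.mp (Finset.mem_filter.mp hz).1).1).1
  · intro z hz hy
    exact eq_of_mem_isolated eq_of_sum_diagonal_eq_zero hω hz hy
  · rw [hM] at hcard
    set d := (isolated (diagonal (R := R)) ω).card
    set b := Fintype.card (CubeSphere r (3 ^ a) R)
    have hr : r * (3 ^ a) ^ 2 + 1 ≤ 2 ^ (r + 4 * a) := by
      have : r + 1 ≤ 2 ^ r := Nat.lt_two_pow_self
      calc r * (3 ^ a) ^ 2 + 1 ≤ (r + 1) * (3 ^ a) ^ 2 := by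
            have : 0 < (3 ^ a) ^ 2 := by positivity
            rw [add_mul]; omega
        _ = (r + 1) * 9 ^ a := by rw [← pow_mul, mul_comm a, pow_mul]; norm_num
        _ ≤ 2 ^ r * 16 ^ a := by gcongr; norm_num
        _ = 2 ^ (r + 4 * a) := by rw [pow_add, pow_mul]; norm_num
    have h3 : ∀ j, 3 ^ j ≤ 2 ^ (2 * j) := fun j => by
      rw [pow_mul]; exact Nat.pow_le_pow_left (by norm_num) j
    have hL : 0 < 3 ^ n * (3 ^ a) ^ r := by positivity
    refine Nat.le_of_mul_le_mul_left ?_ hL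
    calc 3 ^ n * (3 ^ a) ^ r * 2 ^ n = 6 ^ n * (3 ^ a) ^ r := by
          rw [show (6 : ℕ) = 3 * 2 by norm_num, mul_pow]; ring
      _ ≤ 6 ^ n * (b * (r * (3 ^ a) ^ 2 + 1)) := Nat.mul_le_mul_left _ hR
      _ = 6 ^ n * b * (r * (3 ^ a) ^ 2 + 1) := by ring
      _ ≤ 2 * d * (3 ^ r * (3 ^ a) ^ r) ^ 3 * (r * (3 ^ a) ^ 2 + 1) :=
          Nat.mul_le_mul_right _ hcard
      _ = (3 ^ a) ^ r * (2 * d * 3 ^ r * (3 ^ r * (3 ^ a) ^ r) ^ 2 * (r * (3 ^ a) ^ 2 + 1)) := by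
          ring
      _ ≤ (3 ^ a) ^ r * (2 * d * 2 ^ (2 * r) * (3 ^ n * 2 ^ (2 * (10 + 2 * a))) *
            2 ^ (r + 4 * a)) := by
          have h4 : (3 ^ r * (3 ^ a) ^ r) ^ 2 ≤ 3 ^ n * 2 ^ (2 * (10 + 2 * a)) := by
            rw [hM2]
            refine (Nat.pow_le_pow_right (by norm_num) h₂).trans ?_
            rw [add_assoc, pow_add]
            exact Nat.mul_le_mul_left _ (h3 _)
          exact Nat.mul_le_mul_left _
            (Nat.mul_le_mul (Nat.mul_le_mul (Nat.mul_le_mul_left _ (h3 r)) h4) hr)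
      _ = 3 ^ n * (3 ^ a) ^ r * (d * 2 ^ (21 + 8 * a + 3 * r)) := by
          have : 21 + 8 * a + 3 * r = 1 + 2 * r + 2 * (10 + 2 * a) + (r + 4 * a) := by ring
          rw [this]
          simp only [pow_add 2, pow_one]
          ring

theorem unit_apply (y : Fin 4 → Fin 2) :
    unit 4 2 y = if ∀ l, y l = y 0 then 1 else 0 := by
  unfold unit
  rw [Finset.sum_eq_single (y 0)]
  · simp [Finset.prod_ite_zero]
  · intro i _ hi
    exact Finset.prod_eq_zero (Finset.mem_univ 0) (if_neg hi.symm)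
  · simp

theorem unit_tpow_apply {k : ℕ} (y : Fin 4 → Fin k → Fin 2) :
    (unit 4 2).tpow k y = if ∀ l, y l = y 0 then 1 else 0 := by
  unfold tpow
  simp only [unit_apply, Finset.prod_ite_zero, Finset.prod_const_one, Finset.mem_univ, true_imp_iff]
  refine if_congr ⟨fun h l => funext fun j => h j l, fun h j l => congrFun (h l) j⟩ rfl rfl

theorem dicke22_tpow_apply {n : ℕ} (x : Fin 4 → Fin n → Fin 2) :
    dicke22.tpow n x = if (fun t l => x l t) ∈ words n then 1 else 0 := by
  unfold tpow dicke22 dicke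
  rw [Finset.prod_ite_zero]
  simp [mem_words, balanced]

/-- The number of copies of the Dicke tensor used to obtain `k` copies of `T`. -/
def copies (k : ℕ) : ℕ := k + 20 * (Nat.sqrt k + 10)

/-- The `k`-th power of `T` is found among the coefficients of a power of the Dicke tensor. -/
theorem exists_pullback (k : ℕ) :
    ∃ e : Fin 4 → (Fin k → Fin 2) → Fin (copies k) → Fin 2, (∀ l, Function.Injective (e l)) ∧
      ∀ y, (unit 4 2).tpow k y = dicke22.tpow (copies k) fun l => e l (y l) := by
  set s := Nat.sqrt k with hs
  have hk : k ≤ s * s + s + s := Nat.sqrt_le_add k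
  set n := copies k with hn
  have hn' : n = k + 20 * (s + 10) := rfl
  -- With `a = s + 9`, take for `r` the first integer above `(n + 8) / (2 (a + 1))`.
  obtain ⟨r, h₁, h₂⟩ : ∃ r, n + 8 ≤ 2 * (s + 9 + 1) * r ∧
      2 * (s + 9 + 1) * r ≤ n + 10 + 2 * (s + 9) := by
    refine ⟨(n + 8) / (2 * (s + 9 + 1)) + 1, ?_, ?_⟩
    · have := Nat.lt_mul_div_succ (n + 8) (show 0 < 2 * (s + 9 + 1) by omega)
      omega
    · have := Nat.mul_div_le (n + 8) (2 * (s + 9 + 1))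
      rw [mul_add]
      omega
  have hloss : 21 + 8 * (s + 9) + 3 * r + k ≤ n := by
    have : 2 * r ≤ s + 32 := by
      by_contra hlt
      have h3 : s + 33 ≤ 2 * r := by omega
      have := Nat.mul_le_mul_left (s + 10) h3
      nlinarith
    omega
  obtain ⟨B, D, hD, hmatch, hcard⟩ := exists_matching h₁ h₂
  have hcard' : 2 ^ k ≤ D.card := by
    refine Nat.le_of_mul_le_mul_right ?_ (show 0 < 2 ^ (21 + 8 * (s + 9) + 3 * r) by positivity)
    rw [← pow_add]
    exact (Nat.pow_le_pow_right (by norm_num) (by omega)).trans hcard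
  obtain ⟨f⟩ : Nonempty ((Fin k → Fin 2) ↪ D) :=
    Function.Embedding.nonempty_of_card_le (by simpa using hcard')
  have key : ∀ y : Fin 4 → Fin k → Fin 2,
      (∀ l, y l = y 0) ↔ (fun t l => (f (y l)).1.1 t l) ∈ words n := by
    intro y
    constructor
    · intro h
      simp only [h]
      exact hD _ (f (y 0)).2
    · intro h l
      exact f.injective (Subtype.ext (hmatch (fun l => (f (y l)).1) (fun l => (f (y l)).2) h l))
  refine ⟨fun l u t => (f u).1.1 t l, ?_, ?_⟩
  · intro l u u' h
    -- Replacing `u` by `u'` in leg `l` of the constant tuple does not change the resulting word.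
    have h' := (key (Function.update (fun _ => u) l u')).mpr (by
      have : (fun t l' => (f (Function.update (fun _ => u) l u' l')).1.1 t l') =
          (f u).1.1 := by
        funext t l'
        by_cases hl : l' = l
        · subst hl
          simpa using (congrFun h t).symm
        · simp [hl]
      rw [this]
      exact hD _ (f u).2)
    obtain ⟨l', hl'⟩ := exists_ne l
    have e := (h' l).trans (h' l').symm
    simpa [hl'] using e.symm
  · intro y
    rw [unit_tpow_apply, dicke22_tpow_apply]
    exact if_congr (key y) rfl rfl

theorem restricts_copies (k : ℕ) : Restricts (dicke22.tpow (copies k)) ((unit 4 2).tpow k) := by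
  obtain ⟨e, -, h⟩ := exists_pullback k
  exact restricts_of_pullback _ _ e h

theorem monomiallyDegenerates_copies (k : ℕ) :
    MonomiallyDegenerates (dicke22.tpow (copies k)) ((unit 4 2).tpow k) := by
  obtain ⟨e, he, h⟩ := exists_pullback k
  exact monomiallyDegenerates_of_pullback _ _ e he h

end Matching

/-! ### The rates -/

section Rate

theorem det_flattening_unit_ne_zero (k : ℕ) :
    (Matrix.of fun i j : Fin k → Fin 2 =>
      (unit 4 2).tpow k (Function.update (fun _ => j) (0 : Fin 4) i)).det ≠ 0 := by
  have : (Matrix.of fun i j : Fin k → Fin 2 =>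
      (unit 4 2).tpow k (Function.update (fun _ => j) (0 : Fin 4) i)) = 1 := by
    ext i j
    rw [Matrix.of_apply, unit_tpow_apply, Matrix.one_apply]
    refine if_congr ⟨fun h => ?_, fun h l => ?_⟩ rfl rfl
    · simpa using (h 1).symm
    · subst h
      simp
  rw [this, Matrix.det_one]
  exact one_ne_zero

theorem le_of_restricts {m k : ℕ} (h : Restricts (dicke22.tpow m) ((unit 4 2).tpow k)) :
    k ≤ m := by
  have := card_le_of_restricts h (0 : Fin 4) id (fun j _ => j) (det_flattening_unit_ne_zero k)
  simpa [Nat.pow_le_pow_iff_right] using this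

theorem le_of_monomiallyDegenerates {m k : ℕ}
    (h : MonomiallyDegenerates (dicke22.tpow m) ((unit 4 2).tpow k)) : k ≤ m := by
  have := card_le_of_monomiallyDegenerates h (0 : Fin 4) id (fun j _ => j)
    (det_flattening_unit_ne_zero k)
  simpa [Nat.pow_le_pow_iff_right] using this

theorem tendsto_copies_div : Tendsto (fun k : ℕ => ((copies k : ℕ) : ℝ≥0∞) / k) atTop (𝓝 1) := by
  have hsqrt : Tendsto (fun k : ℕ => (20 * (√(k : ℝ) + 10) / k : ℝ)) atTop (𝓝 0) := by
    have h1 : Tendsto (fun k : ℕ => (√(k : ℝ))⁻¹) atTop (𝓝 0) :=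
      (Real.tendsto_sqrt_atTop.comp tendsto_natCast_atTop_atTop).inv_tendsto_atTop
    have h2 : Tendsto (fun k : ℕ => ((k : ℝ))⁻¹) atTop (𝓝 0) := tendsto_inv_atTop_nhds_zero_nat
    have h3 := (h1.const_mul 20).add (h2.const_mul 200)
    simp only [mul_zero, add_zero] at h3
    refine h3.congr' ?_
    filter_upwards [eventually_gt_atTop 0] with k hk
    have hk' : (0 : ℝ) < k := by exact_mod_cast hk
    have hs : √(k : ℝ) ≠ 0 := (Real.sqrt_pos.mpr hk').ne'
    have e : (√(k : ℝ))⁻¹ = √(k : ℝ) / k := by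
      rw [eq_div_iff hk'.ne', inv_mul_eq_iff_eq_mul₀ hs, Real.mul_self_sqrt hk'.le]
    rw [e]
    field_simp
    ring
  have hreal : Tendsto (fun k : ℕ => ((copies k : ℕ) : ℝ) / k) atTop (𝓝 1) := by
    refine tendsto_of_tendsto_of_tendsto_of_le_of_le' tendsto_const_nhds
      (by simpa using hsqrt.const_add 1) ?_ ?_
    · filter_upwards [eventually_gt_atTop 0] with k hk
      have hk' : (0 : ℝ) < k := by exact_mod_cast hk
      rw [one_le_div hk']
      exact_mod_cast Nat.le_add_right _ _
    · filter_upwards [eventually_gt_atTop 0] with k hk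
      have hk' : (0 : ℝ) < k := by exact_mod_cast hk
      rw [div_le_iff₀ hk', add_mul, div_mul_cancel₀ _ hk'.ne', one_mul]
      simp only [copies, Nat.cast_add, Nat.cast_mul, Nat.cast_ofNat]
      have := Real.nat_sqrt_le_real_sqrt (a := k)
      linarith
  have := ENNReal.tendsto_ofReal hreal
  rw [ENNReal.ofReal_one] at this
  refine this.congr' ?_
  filter_upwards [eventually_gt_atTop 0] with k hk
  have hk' : (0 : ℝ) < k := by exact_mod_cast hk
  rw [ENNReal.ofReal_div_of_pos hk', ENNReal.ofReal_natCast, ENNReal.ofReal_natCast]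

/-- A conversion that needs at least `k` and at most `copies k` copies has rate one. -/
theorem tendsto_iInf_div (P : ℕ → ℕ → Prop) (hle : ∀ m k, P m k → k ≤ m)
    (hP : ∀ k, P (copies k) k) :
    Tendsto (fun k : ℕ => (⨅ (m : ℕ) (_ : P m k), (m : ℝ≥0∞)) / k) atTop (𝓝 1) := by
  refine tendsto_of_tendsto_of_tendsto_of_le_of_le' tendsto_const_nhds tendsto_copies_div ?_ ?_
  · filter_upwards [eventually_gt_atTop 0] with k hk
    rw [ENNReal.le_div_iff_mul_le (by simp [hk.ne']) (by simp), one_mul]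
    exact le_iInf₂ fun m hm => by exact_mod_cast hle m k hm
  · exact Eventually.of_forall fun k => ENNReal.div_le_div_right (iInf₂_le (copies k) (hP k)) _

theorem tendsto_rateSeq : Tendsto (rateSeq dicke22 (unit 4 2)) atTop (𝓝 1) :=
  tendsto_iInf_div (fun m k => Restricts (dicke22.tpow m) ((unit 4 2).tpow k))
    (fun _ _ => le_of_restricts) restricts_copies

theorem tendsto_monomialRateSeq : Tendsto (monomialRateSeq dicke22 (unit 4 2)) atTop (𝓝 1) :=
  tendsto_iInf_div (fun m k => MonomiallyDegenerates (dicke22.tpow m) ((unit 4 2).tpow k))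
    (fun _ _ => le_of_monomiallyDegenerates) monomiallyDegenerates_copies

end Rate

end KTensor

/-- The weight-`(2,2)` Dicke tensor `D` satisfies `q_M(D) = q(D) = 1`; the limits that define
`q_M(D)` and `q(D)` exist. -/
theorem mainTheorem4 :
    (Tendsto (KTensor.monomialRateSeq KTensor.dicke22 (KTensor.unit 4 2)) atTop
        (𝓝 (KTensor.monomialRate KTensor.dicke22 (KTensor.unit 4 2))) ∧
      Tendsto (KTensor.rateSeq KTensor.dicke22 (KTensor.unit 4 2)) atTop
        (𝓝 (KTensor.rate KTensor.dicke22 (KTensor.unit 4 2)))) ∧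
    KTensor.monomialSubexponent KTensor.dicke22 = KTensor.subexponent KTensor.dicke22 ∧
    KTensor.subexponent KTensor.dicke22 = 1 := by
  have hr : KTensor.rate KTensor.dicke22 (KTensor.unit 4 2) = 1 :=
    KTensor.tendsto_rateSeq.limUnder_eq
  have hm : KTensor.monomialRate KTensor.dicke22 (KTensor.unit 4 2) = 1 :=
    KTensor.tendsto_monomialRateSeq.limUnder_eq
  refine ⟨⟨?_, ?_⟩, ?_, ?_⟩
  · rw [hm]
    exact KTensor.tendsto_monomialRateSeq
  · rw [hr]
    exact KTensor.tendsto_rateSeq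
  · rw [KTensor.monomialSubexponent, KTensor.subexponent, hm, hr]
  · rw [KTensor.subexponent, hr, inv_one]
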